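/- Let $r$ be a non-negative integer, let $\mathbb A=\{1,\dots,r\}$, and let $\mathcal B$ be the set of biwords $\binom{x_1\cdots x_n}{a_1\cdots a_n}$ ($n\ge 0$, $x_i,a_i\in\mathbb A$), viewed as words in the biletters $\binom{x}{a}$ and multiplied by concatenation. Let $\mathcal A_q=\mathbb Z[q,q^{-1}]\langle\!\langle\mathcal B\rangle\!\rangle$ be the algebra of all (possibly infinite) formal sums $\sum_{\alpha\in\mathcal B}c(\alpha)\,\alpha$ with $c(\alpha)\in\mathbb Z[q,q^{-1}]$. For a word $w$ let $\mathrm{inv}\,w$ be its number of inversions and $\overline w$ its non-decreasing rearrangement. Put $$\mathrm{Bos}(1)=\sum_{w\in\mathbb A^*}\binom{\overline w}{w},\qquad \mathrm{Ferm}(1)=\sum_{J\subset\mathbb A}(-1)^{|J|}\sum_{\sigma\in\mathfrak S_J}(-1)^{\mathrm{inv}\,\sigma}\binom{\sigma(i_1)\cdots\sigma(i_l)}{i_1\cdots i_l},$$ where $J=\{i_1<\cdots<i_l\}$, $\mathfrak S_J$ is the group of permutations of $J$, and $\mathrm{inv}\,\sigma$ is the number of inversions of the word $\sigma(i_1)\cdots\sigma(i_l)$.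 Let $(SH)$ be the system of relations, for $x,y,a,b\in\mathbb A$ with $x>y$, $$\binom{xy}{ab}=\binom{yx}{ab}\ \text{ if } V(x,y,a,b)>0,\qquad \binom{xy}{ab}=\binom{yx}{ba}\ \text{ if } V(x,y,a,b)<0,$$ where $V(x,y,a,b)=(a-x-\tfrac12)(a-y-\tfrac12)(b-x-\tfrac12)(b-y-\tfrac12)$. Let $\mathcal I(SH)$ be the closed two-sided ideal of $\mathcal A_q$ generated by the differences $\alpha-E_\alpha$ of the two sides of these relations; that is, the closure, for coefficientwise convergence of formal sums (each coefficient being eventually constant), of the two-sided ideal that they generate. Let $\mathcal H=\mathcal A_q/\mathcal I(SH)$ be the contextual algebra. **Theorem (1-quantum Master Theorem for $\mathcal H$).** For every $r$, $$\mathrm{Ferm}(1)\times\mathrm{Bos}(1)\equiv 1 \pmod{\mathcal I(SH)},$$ that is, the image of $\mathrm{Ferm}(1)\times\mathrm{Bos}(1)$ in $\mathcal H$ is $1$. -/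

import Mathlib

/-- Biwords on the alphabet with `r` letters, written as words of biletters; the biletter with top
entry `x` and bottom entry `a` is the pair `(x, a)`. The alphabet is `Fin r`, with its order. -/
abbrev Biword (r : ℕ) : Type := List (Fin r × Fin r)

/-- The large algebra `K⟨⟨𝓑⟩⟩` of all (possibly infinite) formal sums `∑ c(α) α` of biwords; such a
sum is the function `α ↦ c(α)`. -/
def Expr (K : Type) (r : ℕ) : Type := Biword r → K

namespace Expr

@[ext] theorem ext {K : Type} {r : ℕ} {E F : Expr K r} (h : ∀ β, E β = F β) : E = F := funext h

variable {K : Type} [CommRing K] {r : ℕ}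

instance : AddCommGroup (Expr K r) := inferInstanceAs (AddCommGroup (Biword r → K))

instance : Module K (Expr K r) := inferInstanceAs (Module K (Biword r → K))

/-- A biword, as a formal sum with one term. -/
def single (α : Biword r) : Expr K r := fun β => if β = α then 1 else 0

instance : One (Expr K r) := ⟨single []⟩

/-- The product extending the concatenation of biwords: the coefficient of `β` in `E * F` is the
sum of `E(β₁) F(β₂)` over all factorizations `β = β₁β₂`. -/
instance : Mul (Expr K r) :=
  ⟨fun E F β => ∑ i ∈ Finset.range (β.length + 1), E (β.take i) * F (β.drop i)⟩

theorem add_apply (E F : Expr K r) (β : Biword r) : (E + F) β = E β + F β := rfl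

theorem neg_apply (E : Expr K r) (β : Biword r) : (-E) β = -E β := rfl

theorem sub_apply (E F : Expr K r) (β : Biword r) : (E - F) β = E β - F β := rfl

theorem zero_apply (β : Biword r) : (0 : Expr K r) β = 0 := rfl

theorem smul_apply (c : K) (E : Expr K r) (β : Biword r) : (c • E) β = c * E β := rfl

theorem one_apply (β : Biword r) : (1 : Expr K r) β = if β = [] then 1 else 0 := rfl

theorem mul_apply (E F : Expr K r) (β : Biword r) :
    (E * F) β = ∑ i ∈ Finset.range (β.length + 1), E (β.take i) * F (β.drop i) := rfl

protected theorem mul_assoc (E F G : Expr K r) : E * F * G = E * (F * G) := by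
  ext β
  simp only [mul_apply, Finset.sum_mul, Finset.mul_sum]
  rw [Finset.sum_sigma', Finset.sum_sigma']
  refine Finset.sum_bij' (fun p _ => ⟨p.2, p.1 - p.2⟩) (fun p _ => ⟨p.1 + p.2, p.1⟩)
    ?_ ?_ ?_ ?_ ?_
  · rintro ⟨i, j⟩ h
    simp at h ⊢
    omega
  · rintro ⟨i, j⟩ h
    simp at h ⊢
    omega
  · rintro ⟨i, j⟩ h
    simp at h ⊢
    omega
  · rintro ⟨i, j⟩ h
    simp
  · rintro ⟨i, j⟩ h
    simp only [Finset.mem_sigma, Finset.mem_range, List.length_take] at h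
    have hji : j ≤ i := by omega
    simp only [List.take_take, List.drop_drop, List.drop_take, min_eq_left hji,
      Nat.add_sub_cancel' hji, mul_assoc]

protected theorem one_mul (E : Expr K r) : 1 * E = E := by
  ext β
  rw [mul_apply, Finset.sum_eq_single 0]
  · simp [one_apply]
  · intro i hi hi0
    rw [Finset.mem_range] at hi
    have : β.take i ≠ [] := by
      intro h
      have := congrArg List.length h
      rw [List.length_take, List.length_nil] at this
      omega
    simp [one_apply, this]
  · simp

protected theorem mul_one (E : Expr K r) : E * 1 = E := by
  ext β
  rw [mul_apply, Finset.sum_eq_single β.length]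
  · simp [one_apply]
  · intro i hi hi0
    rw [Finset.mem_range] at hi
    have : β.drop i ≠ [] := by
      intro h
      have := congrArg List.length h
      rw [List.length_drop, List.length_nil] at this
      omega
    simp [one_apply, this]
  · simp

instance : Ring (Expr K r) :=
  { (inferInstance : AddCommGroup (Expr K r)) with
    mul := (· * ·)
    one := 1
    mul_assoc := Expr.mul_assoc
    one_mul := Expr.one_mul
    mul_one := Expr.mul_one
    left_distrib := fun E F G => by
      ext β; simp only [mul_apply, add_apply, mul_add, Finset.sum_add_distrib]
    right_distrib := fun E F G => by
      ext β; simp only [mul_apply, add_apply, add_mul, Finset.sum_add_distrib]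
    zero_mul := fun E => by ext β; simp [mul_apply, zero_apply]
    mul_zero := fun E => by ext β; simp [mul_apply, zero_apply] }

end Expr

/-- The number of inversions of a word: pairs of positions `i < j` whose entries satisfy
`wᵢ > wⱼ`. -/
def invCount {r : ℕ} (w : List (Fin r)) : ℕ :=
  (Finset.univ.filter
    (fun p : Fin w.length × Fin w.length => p.1 < p.2 ∧ w.get p.2 < w.get p.1)).card

/-- The `q`-Boson `∑_w q^(inv w) (w̄ over w)`, where `w̄` is the non-decreasing rearrangement of `w`:
a biword is a term of the sum exactly when its top word is the non-decreasing rearrangement of its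
bottom word `w`, and then for that `w` only. -/
def bos {K : Type} [CommRing K] (r : ℕ) (q : K) : Expr K r := fun β =>
  if β.map Prod.fst = (β.map Prod.snd).insertionSort (· ≤ ·) then q ^ invCount (β.map Prod.snd) else 0

/-- The biword with top word `σ(i₁) ⋯ σ(iₗ)` and bottom word `i₁ ⋯ iₗ`, for
`J = {i₁ < ⋯ < iₗ}` and a permutation `σ` of `J`. -/
def permBiword {r : ℕ} (J : Finset (Fin r)) (σ : Equiv.Perm J) : Biword r :=
  (J.attach.sort (· ≤ ·)).map fun i => ((σ i : Fin r), (i : Fin r))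

/-- The Fermion at `q = 1`: the sum of `(-1)^|J| (-1)^(inv σ) (σ(i₁)⋯σ(iₗ) over i₁⋯iₗ)` over all
subsets `J` of the alphabet and all permutations `σ` of `J`. -/
def fermOne (K : Type) [CommRing K] (r : ℕ) : Expr K r :=
  ∑ J : Finset (Fin r), ∑ σ : Equiv.Perm J,
    ((-1 : K) ^ J.card * (-1) ^ invCount ((permBiword J σ).map Prod.fst)) •
      Expr.single (permBiword J σ)

/-- `V(x,y,a,b) = (a-x-1/2)(a-y-1/2)(b-x-1/2)(b-y-1/2)`. -/
def contextV {r : ℕ} (x y a b : Fin r) : ℚ :=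
  ((a : ℕ) - (x : ℕ) - 1 / 2 : ℚ) * ((a : ℕ) - (y : ℕ) - 1 / 2 : ℚ) *
    ((b : ℕ) - (x : ℕ) - 1 / 2 : ℚ) * ((b : ℕ) - (y : ℕ) - 1 / 2 : ℚ)

/-- The reduction system `(SH)`, as a set of pairs `(α, E_α)`: for `x > y`,
`(xy over ab) = (yx over ab)` if `V(x,y,a,b) > 0` and
`(xy over ab) = (yx over ba)` if `V(x,y,a,b) < 0`. -/
def systemSH (K : Type) [CommRing K] (r : ℕ) : Set (Biword r × Expr K r) :=
  {p | ∃ x y a b : Fin r, y < x ∧ 0 < contextV x y a b ∧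
      p = ([(x, a), (y, b)], Expr.single [(y, a), (x, b)])} ∪
  {p | ∃ x y a b : Fin r, y < x ∧ contextV x y a b < 0 ∧
      p = ([(x, a), (y, b)], Expr.single [(y, b), (x, a)])}

section Ideal

variable {K : Type} [CommRing K] {r : ℕ}

/-- The two-sided ideal of the large algebra generated, algebraically, by the elements
`α - E_α`. -/
def algebraicIdeal (S : Set (Biword r × Expr K r)) : TwoSidedIdeal (Expr K r) :=
  TwoSidedIdeal.span {E | ∃ p ∈ S, E = Expr.single p.1 - p.2}

/-- The two-sided ideal `𝓘(S)` of the large algebra generated by the elements `α - E_α` in the sense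
appropriate to an algebra of infinite formal sums, that is, the closed ideal they generate: the
closure of the algebraic ideal for coefficientwise convergence. An expression belongs to it when,
for every `N`, its coefficients on the biwords of length less than `N` agree with those of an
element of the algebraic ideal. -/
def reductionIdeal (S : Set (Biword r × Expr K r)) : TwoSidedIdeal (Expr K r) :=
  TwoSidedIdeal.mk'
    {E | ∀ N : ℕ, ∃ G ∈ algebraicIdeal S, ∀ β : Biword r, β.length < N → E β = G β}
    (fun _ => ⟨0, (algebraicIdeal S).zero_mem, fun _ _ => rfl⟩)
    (fun {E F} hE hF N => by
      obtain ⟨G, hG, h⟩ := hE N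
      obtain ⟨G', hG', h'⟩ := hF N
      exact ⟨G + G', (algebraicIdeal S).add_mem hG hG', fun β hβ => by
        rw [Expr.add_apply, Expr.add_apply, h β hβ, h' β hβ]⟩)
    (fun {E} hE N => by
      obtain ⟨G, hG, h⟩ := hE N
      exact ⟨-G, (algebraicIdeal S).neg_mem hG, fun β hβ => by
        rw [Expr.neg_apply, Expr.neg_apply, h β hβ]⟩)
    (fun {E F} hF N => by
      obtain ⟨G, hG, h⟩ := hF N
      refine ⟨E * G, (algebraicIdeal S).mul_mem_left E G hG, fun β hβ => ?_⟩
      rw [Expr.mul_apply, Expr.mul_apply]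
      refine Finset.sum_congr rfl fun i _ => ?_
      rw [h (β.drop i) (by rw [List.length_drop]; omega)])
    (fun {E F} hE N => by
      obtain ⟨G, hG, h⟩ := hE N
      refine ⟨G * F, (algebraicIdeal S).mul_mem_right G F hG, fun β hβ => ?_⟩
      rw [Expr.mul_apply, Expr.mul_apply]
      refine Finset.sum_congr rfl fun i _ => ?_
      rw [h (β.take i) (by rw [List.length_take]; omega)])

/-- The quotient algebra `𝓤(S)` of the large algebra by `𝓘(S)`. -/
abbrev QuotientAlgebra (S : Set (Biword r × Expr K r)) : Type := (reductionIdeal S).ringCon.Quotient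

/-- The canonical projection of the large algebra onto `𝓤(S)`. -/
def toQuotient (S : Set (Biword r × Expr K r)) : Expr K r →+* QuotientAlgebra S :=
  (reductionIdeal S).ringCon.mk'

end Ideal

/-- The contextual algebra `𝓗 = 𝓤(SH)`, with coefficients in `ℤ[q,q⁻¹]`. -/
abbrev ContextualAlgebra (r : ℕ) : Type := QuotientAlgebra (systemSH (LaurentPolynomial ℤ) r)

/-! Modulo (SH) the biletters form a right-quantum matrix at q = 1 (`isRightQuantum_letter`), and
nothing else about (SH) is used. For such a matrix X, the sums of products over rearrangements of a
bottom content depend only on the content of the top word (`symSum_perm`), and the alternating sums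
over orderings of a top set are alternating in the bottom word (`altSum_swap`, `altSum_self`): X
acts on a symmetric algebra S and on an exterior algebra Λ.

The part of Ferm(1) × Bos(1) of content M is then the alternating trace of X on the degree-M
component of the Koszul complex Λ ⊗ S. The action commutes with the Koszul differential
(`sum_altSum_mul_symSum`). For M ≠ 0, let k be the largest letter of M and pair each J not
containing k with J ∪ {k}. The commutation turns each difference of paired diagonal entries into
off-diagonal terms, and these cancel one by one over all J, so that no trace property over a
noncommutative ring is needed (`koszulTrace_eq_zero`).

Hence every part of nonzero content lies in the algebraic ideal. Biwords shorter than N have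
finitely many contents, so Ferm(1) × Bos(1) - 1 lies in the closure. -/

section RightQuantum

variable {A R : Type*} [LinearOrder A] [Ring R]

/-! ### Right-quantum matrices and their symmetric and alternating sums. -/

/-- The right-quantum relations at `q = 1`: entries of a column commute, and so do the linear forms
`∑ₐ X x a tₐ` in commuting variables `tₐ`. -/
structure IsRightQuantum (X : A → A → R) : Prop where
  column : ∀ x y a, X x a * X y a = X y a * X x a
  cross : ∀ x y a b, X x a * X y b + X x b * X y a = X y a * X x b + X y b * X x a

/-- The sum of the products `X u₁ w₁ ⋯ X uₙ wₙ` over all rearrangements `w` of the multiset `p`. -/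
def symSum (X : A → A → R) : List A → Multiset A → R
  | [], p => if p = 0 then 1 else 0
  | x :: u, p => ∑ i ∈ p.toFinset, X x i * symSum X u (p.erase i)

/-- The alternating sum of the products `X u₁ bₗ ⋯ X uₗ b₁` over all orderings `u` of the set `J`,
where `b = b₁ ⋯ bₗ`; the definition is the Laplace expansion along the rightmost factor. -/
def altSum (X : A → A → R) : Finset A → List A → R
  | J, [] => if J = ∅ then 1 else 0
  | J, i :: b =>
    ∑ j ∈ J, (-1) ^ (J.filter (j < ·)).card * altSum X (J.erase j) b * X j i

theorem map_symSum {R' : Type*} [Ring R'] (f : R →+* R') (X : A → A → R) (u : List A)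
    (p : Multiset A) : f (symSum X u p) = symSum (fun x a => f (X x a)) u p := by
  induction u generalizing p with
  | nil => simp only [symSum]; split_ifs <;> simp
  | cons x u ih => simp [symSum, ih]

theorem map_altSum {R' : Type*} [Ring R'] (f : R →+* R') (X : A → A → R) (J : Finset A)
    (b : List A) : f (altSum X J b) = altSum (fun x a => f (X x a)) J b := by
  induction b generalizing J with
  | nil => simp only [altSum]; split_ifs <;> simp
  | cons x u ih => simp [altSum, ih]

/-- The difference is a sum over ordered pairs (i, j) of bottom letters: the cross relation cancels
(i, j) against (j, i), and the column relation kills i = j. -/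
theorem symSum_swap {X : A → A → R} (hX : IsRightQuantum X) (x y : A) (u : List A)
    (p : Multiset A) : symSum X (x :: y :: u) p = symSum X (y :: x :: u) p := by
  rw [← sub_eq_zero]
  simp only [symSum, Finset.mul_sum]
  rw [← Finset.sum_sub_distrib]
  simp only [← Finset.sum_sub_distrib]
  rw [Finset.sum_sigma']
  refine Finset.sum_involution (fun s _ => ⟨s.2, s.1⟩) ?_ ?_ ?_ (fun _ _ => rfl)
  · rintro ⟨i, j⟩ -
    have h := hX.cross x y i j
    rw [Multiset.erase_comm p j i]
    simp only [← mul_assoc, ← sub_mul, ← add_mul]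
    rw [sub_add_sub_comm, h, add_comm, sub_eq_zero.2, zero_mul]
    rw [add_comm]
  · rintro ⟨i, j⟩ - h e
    obtain rfl : j = i := by simpa using congrArg Sigma.fst e
    exact h (by simp [← mul_assoc, hX.column x y j])
  · rintro ⟨i, j⟩ h
    simp only [Finset.mem_sigma, Multiset.mem_toFinset] at h ⊢
    obtain ⟨h1, h2⟩ := h
    refine ⟨Multiset.mem_of_mem_erase h2, ?_⟩
    by_cases e : i = j
    · subst e; exact h2
    · exact (Multiset.mem_erase_of_ne e).2 h1

theorem symSum_perm {X : A → A → R} (hX : IsRightQuantum X) {u v : List A} (h : u.Perm v)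
    (p : Multiset A) : symSum X u p = symSum X v p := by
  induction h generalizing p with
  | nil => rfl
  | cons x _ ih => simp only [symSum, ih]
  | swap x y l => exact symSum_swap hX y x l p
  | trans _ _ ih1 ih2 => rw [ih1, ih2]

theorem symSum_sort_cons {X : A → A → R} (hX : IsRightQuantum X) (x : A) (m p : Multiset A) :
    symSum X ((x ::ₘ m).sort (· ≤ ·)) p =
      ∑ i ∈ p.toFinset, X x i * symSum X (m.sort (· ≤ ·)) (p.erase i) := by
  rw [symSum_perm hX (v := x :: m.sort (· ≤ ·)), symSum]
  rw [← Multiset.coe_eq_coe]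
  simp [← Multiset.cons_coe]

/-! ### Antisymmetry of the alternating sums. -/

theorem sum_sum_erase_eq_zero (J : Finset A) (g : A → A → R)
    (h : ∀ j ∈ J, ∀ k ∈ J, j ≠ k → g j k + g k j = 0) :
    ∑ j ∈ J, ∑ k ∈ J.erase j, g j k = 0 := by
  rw [Finset.sum_sigma']
  refine Finset.sum_involution (fun s _ => ⟨s.2, s.1⟩) ?_ ?_ ?_ (fun _ _ => rfl)
  · rintro ⟨i, j⟩ hs
    simp only [Finset.mem_sigma, Finset.mem_erase] at hs
    exact h _ hs.1 _ hs.2.2 hs.2.1.symm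
  · rintro ⟨i, j⟩ hs - e
    simp only [Finset.mem_sigma, Finset.mem_erase] at hs
    exact hs.2.1 (by simpa using congrArg Sigma.fst e)
  · rintro ⟨i, j⟩ hs
    simp only [Finset.mem_sigma, Finset.mem_erase] at hs ⊢
    exact ⟨hs.2.2, hs.2.1.symm, hs.1⟩

/-- Only the count for the smaller letter sees the larger one, so reversing the order of deletion
shifts the total exponent by one. -/
theorem neg_one_pow_card_filter_erase (J : Finset A) {j k : A} (hj : j ∈ J) (hk : k ∈ J)
    (hjk : j ≠ k) :
    (-1 : R) ^ (J.filter (j < ·)).card * (-1) ^ ((J.erase j).filter (k < ·)).card =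
      -((-1) ^ (J.filter (k < ·)).card * (-1) ^ ((J.erase k).filter (j < ·)).card) := by
  wlog h : j < k generalizing j k
  · rw [this hk hj hjk.symm (lt_of_le_of_ne (not_lt.1 h) hjk.symm), neg_neg]
  have h1 : (J.erase j).filter (k < ·) = J.filter (k < ·) := by
    ext x; simp only [Finset.mem_filter, Finset.mem_erase]
    constructor
    · tauto
    · rintro ⟨hx, hkx⟩; exact ⟨⟨(h.trans hkx).ne', hx⟩, hkx⟩
  have h2 : (J.erase k).filter (j < ·) = (J.filter (j < ·)).erase k := by
    ext x; simp only [Finset.mem_filter, Finset.mem_erase]; tauto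
  have h3 : k ∈ J.filter (j < ·) := Finset.mem_filter.2 ⟨hk, h⟩
  rw [h1, h2, ← Finset.card_erase_add_one h3, pow_succ]
  simp only [← pow_add, mul_neg_one, neg_mul]
  rw [add_comm]

theorem neg_one_pow_mul_comm (n : ℕ) (a : R) : a * (-1) ^ n = (-1) ^ n * a :=
  (((Commute.one_right a).neg_right).pow_right n).eq

theorem altSum_cons_cons (X : A → A → R) (J : Finset A) (i j : A) (b : List A) :
    altSum X J (i :: j :: b) = ∑ x ∈ J, ∑ y ∈ J.erase x,
      ((-1) ^ (J.filter (x < ·)).card * (-1) ^ ((J.erase x).filter (y < ·)).card) *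
        (altSum X ((J.erase x).erase y) b * (X y j * X x i)) := by
  simp only [altSum, Finset.mul_sum, Finset.sum_mul, mul_assoc]

/-- The two sides together involve X y j X x i + X y i X x j, which the cross relation makes
symmetric in x and y, against a sign antisymmetric in x and y. -/
theorem altSum_swap {X : A → A → R} (hX : IsRightQuantum X) (J : Finset A) (i j : A)
    (b : List A) : altSum X J (i :: j :: b) = -altSum X J (j :: i :: b) := by
  rw [eq_neg_iff_add_eq_zero, altSum_cons_cons, altSum_cons_cons, ← Finset.sum_add_distrib]
  simp only [← Finset.sum_add_distrib, ← mul_add]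
  refine sum_sum_erase_eq_zero J _ fun x hx y hy hxy => ?_
  rw [neg_one_pow_card_filter_erase J hx hy hxy, Finset.erase_right_comm, neg_mul,
    neg_add_eq_zero, add_comm (X x j * X y i), hX.cross x y i j, add_comm (X y i * X x j)]

theorem altSum_self {X : A → A → R} (hX : IsRightQuantum X) (J : Finset A) (i : A)
    (b : List A) : altSum X J (i :: i :: b) = 0 := by
  rw [altSum_cons_cons]
  refine sum_sum_erase_eq_zero J _ fun x hx y hy hxy => ?_
  rw [neg_one_pow_card_filter_erase J hx hy hxy, Finset.erase_right_comm, neg_mul,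
    neg_add_eq_zero, hX.column x y i]

/-- Antisymmetry carries i along b until it meets its copy. -/
theorem altSum_cons_of_mem {X : A → A → R} (hX : IsRightQuantum X) (i : A) {b : List A}
    (hb : b.Pairwise (· ≥ ·)) (hi : i ∈ b) (J : Finset A) : altSum X J (i :: b) = 0 := by
  induction b generalizing J with
  | nil => simp at hi
  | cons c b ih =>
    rcases eq_or_ne i c with rfl | h
    · exact altSum_self hX J i b
    · have hi' : i ∈ b := by simpa [h] using hi
      rw [altSum_swap hX, altSum]
      simp [ih (List.pairwise_cons.1 hb).2 hi']

/-- Sorting i into place moves it past each larger letter, at the cost of one sign each. -/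
theorem altSum_cons_eq_orderedInsert {X : A → A → R} (hX : IsRightQuantum X) (i : A)
    {b : List A} (hb : b.Pairwise (· ≥ ·)) (J : Finset A) :
    altSum X J (i :: b) =
      (-1) ^ b.countP (i < ·) * altSum X J (b.orderedInsert (· ≥ ·) i) := by
  induction b generalizing J with
  | nil => simp
  | cons c b ih =>
    have hb' := List.pairwise_cons.1 hb
    by_cases h : i ≥ c
    · have h0 : (c :: b).countP (i < ·) = 0 := by
        rw [List.countP_eq_zero]
        intro x hx
        rcases List.mem_cons.1 hx with rfl | hx
        · simpa using h
        · simpa using (hb'.1 x hx).trans h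
      rw [h0, List.orderedInsert_cons_of_le _ _ h]; simp
    · rw [altSum_swap hX, List.orderedInsert_of_not_le _ _ h, altSum, altSum]
      simp only [ih hb'.2]
      rw [List.countP_cons_of_pos (by simpa using h), Finset.mul_sum, ← Finset.sum_neg_distrib]
      refine Finset.sum_congr rfl fun x _ => ?_
      rw [pow_succ]
      simp only [mul_neg_one, neg_mul, ← mul_assoc]
      rw [neg_one_pow_mul_comm]

theorem altSum_cons_sort {X : A → A → R} (hX : IsRightQuantum X) {i : A} {I : Finset A}
    (hi : i ∉ I) (J : Finset A) :
    altSum X J (i :: I.sort (· ≥ ·)) =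
      (-1) ^ (I.filter (i < ·)).card * altSum X J ((insert i I).sort (· ≥ ·)) := by
  rw [altSum_cons_eq_orderedInsert hX i (Finset.pairwise_sort I (· ≥ ·))]
  congr 2
  · rw [← Multiset.coe_countP, Finset.sort_eq, Multiset.countP_eq_card_filter]
    rfl
  · refine List.Perm.eq_of_pairwise (le := (· ≥ ·)) (fun a b _ _ h h' => le_antisymm h' h)
      ((Finset.pairwise_sort I (· ≥ ·)).orderedInsert i _) (Finset.pairwise_sort _ _) ?_
    rw [← Multiset.coe_eq_coe, Finset.sort_eq, Finset.insert_val_of_notMem hi,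
      Multiset.coe_eq_coe.2 (List.perm_orderedInsert _ i _), ← Multiset.cons_coe, Finset.sort_eq]

theorem sort_insert_of_lt {J : Finset A} {k : A} (hk : ∀ j ∈ J, j < k) :
    (insert k J).sort (· ≥ ·) = k :: J.sort (· ≥ ·) :=
  Finset.sort_insert _ (fun j hj => (hk j hj).le) fun h => (hk k h).false

/-! ### Vanishing of the Koszul trace. -/

/-- The matrix entries of the Koszul differential commute with the coaction. -/
theorem sum_altSum_mul_symSum {X : A → A → R} (hX : IsRightQuantum X) (J : Finset A)
    (b : List A) (m p : Multiset A) :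
    ∑ i ∈ p.toFinset, altSum X J (i :: b) * symSum X (m.sort (· ≤ ·)) (p.erase i) =
      ∑ j ∈ J, (-1) ^ (J.filter (j < ·)).card * altSum X (J.erase j) b *
        symSum X ((j ::ₘ m).sort (· ≤ ·)) p := by
  simp only [symSum_sort_cons hX, altSum, Finset.sum_mul, Finset.mul_sum, mul_assoc]
  exact Finset.sum_comm

theorem sub_val_insert (M : Multiset A) {J : Finset A} {a : A} (ha : a ∉ J) :
    M - (insert a J).val = (M - J.val).erase a := by
  rw [Finset.insert_val_of_notMem ha, ← Multiset.sub_singleton, ← tsub_add_eq_tsub_tsub,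
    ← Multiset.singleton_add, add_comm]

/-- The part with top and bottom content `M` of the product of the Fermion and the Boson. -/
def koszulTrace (X : A → A → R) (M : Multiset A) : R :=
  ∑ J ∈ M.toFinset.powerset, (-1) ^ J.card *
    (altSum X J (J.sort (· ≥ ·)) * symSum X ((M - J.val).sort (· ≤ ·)) (M - J.val))

theorem koszulTrace_eq_zero {X : A → A → R} (hX : IsRightQuantum X) {M : Multiset A}
    (hM : M ≠ 0) : koszulTrace X M = 0 := by
  have hne : M.toFinset.Nonempty := by simpa [Finset.nonempty_iff_ne_empty] using hM
  -- A maximal k stands at the head of the descending word of J ∪ {k} and carries no sign.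
  set k := M.toFinset.max' hne with hk
  have hkM : k ∈ M.toFinset := Finset.max'_mem _ _
  set K := M.toFinset.erase k with hK
  have hlt : ∀ j ∈ K, j < k := fun j hj =>
    lt_of_le_of_ne (Finset.le_max' _ _ (Finset.mem_of_mem_erase hj)) (Finset.ne_of_mem_erase hj)
  have hkK : k ∉ K := Finset.notMem_erase _ _
  -- In the Koszul identity for J ∪ {k}, the terms i = k and j = k are the diagonal entries at J ∪
  -- {k} and at J; the remaining terms are off-diagonal.
  have key : ∀ J ∈ K.powerset,
      altSum X J (J.sort (· ≥ ·)) * symSum X ((M - J.val).sort (· ≤ ·)) (M - J.val) -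
        altSum X (insert k J) ((insert k J).sort (· ≥ ·)) *
          symSum X ((M - (insert k J).val).sort (· ≤ ·)) (M - (insert k J).val) =
      ∑ i ∈ K \ J, altSum X (insert k J) (i :: J.sort (· ≥ ·)) *
          symSum X ((M - (insert k J).val).sort (· ≤ ·)) ((M - J.val).erase i) -
      ∑ j ∈ J, (-1) ^ ((insert k J).filter (j < ·)).card *
        altSum X ((insert k J).erase j) (J.sort (· ≥ ·)) *
        symSum X ((j ::ₘ (M - (insert k J).val)).sort (· ≤ ·)) (M - J.val) := by
    intro J hJ
    rw [Finset.mem_powerset] at hJ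
    have hkJ : k ∉ J := fun h => hkK (hJ h)
    have hkm : k ∈ M - J.val := by
      rw [Multiset.mem_sub, Multiset.count_eq_zero_of_notMem (by simpa using hkJ)]
      exact Multiset.count_pos.2 (by simpa using hkM)
    have hm : M - (insert k J).val = (M - J.val).erase k := sub_val_insert M hkJ
    have h := sum_altSum_mul_symSum hX (insert k J) (J.sort (· ≥ ·)) (M - (insert k J).val)
      (M - J.val)
    rw [← Finset.add_sum_erase _ _ (show k ∈ (M - J.val).toFinset by simpa using hkm),
      Finset.sum_insert hkJ, Finset.erase_insert hkJ, hm, Multiset.cons_erase hkm,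
      ← sort_insert_of_lt (fun j hj => hlt j (hJ hj))] at h
    have h0 : (insert k J).filter (k < ·) = ∅ := by
      rw [Finset.filter_eq_empty_iff]
      intro x hx
      rcases Finset.mem_insert.1 hx with rfl | hx
      · exact lt_irrefl _
      · exact (hlt x (hJ hx)).not_gt
    rw [h0, Finset.card_empty, pow_zero, one_mul] at h
    -- A letter of J survives in M - J when M repeats it; its term then has a repeated bottom letter
    -- and vanishes.
    have hs : ∑ i ∈ (M - J.val).toFinset.erase k, altSum X (insert k J) (i :: J.sort (· ≥ ·)) *
          symSum X (((M - J.val).erase k).sort (· ≤ ·)) ((M - J.val).erase i) =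
        ∑ i ∈ K \ J, altSum X (insert k J) (i :: J.sort (· ≥ ·)) *
          symSum X (((M - J.val).erase k).sort (· ≤ ·)) ((M - J.val).erase i) := by
      symm
      apply Finset.sum_subset
      · intro i hi
        simp only [hK, Finset.mem_sdiff, Finset.mem_erase, Multiset.mem_toFinset] at hi ⊢
        refine ⟨hi.1.1, ?_⟩
        rw [Multiset.mem_sub, Multiset.count_eq_zero_of_notMem (by simpa using hi.2)]
        exact Multiset.count_pos.2 hi.1.2
      · intro i hi hi'
        have hiJ : i ∈ J := by
          by_contra hc
          apply hi'
          simp only [hK, Finset.mem_sdiff, Finset.mem_erase, Multiset.mem_toFinset] at hi ⊢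
          exact ⟨⟨hi.1, Multiset.mem_of_le (Multiset.sub_le_self _ _) hi.2⟩, hc⟩
        rw [altSum_cons_of_mem hX i (Finset.pairwise_sort J (· ≥ ·)) (by simpa using hiJ),
          zero_mul]
    rw [hs] at h
    rw [hm]
    rw [sub_eq_sub_iff_add_eq_add, ← h, add_comm]
  rw [koszulTrace, ← Finset.insert_erase hkM, Finset.sum_powerset_insert hkK,
    ← Finset.sum_add_distrib]
  have hterm : ∀ J ∈ K.powerset, ∀ a b : R,
      (-1) ^ J.card * a + (-1) ^ (insert k J).card * b = (-1) ^ J.card * (a - b) := by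
    intro J hJ a b
    rw [Finset.card_insert_of_notMem fun h => hkK (Finset.mem_powerset.1 hJ h),
      pow_succ, mul_neg_one, neg_mul, ← sub_eq_add_neg, ← mul_sub]
  rw [Finset.sum_congr rfl fun J hJ =>
    (hterm J hJ _ _).trans (congrArg ((-1) ^ J.card * ·) (key J hJ))]
  simp only [mul_sub, Finset.sum_sub_distrib, Finset.mul_sum]
  rw [sub_eq_zero, Finset.sum_sigma', Finset.sum_sigma']
  -- The left term at (J, i) equals the right term at (J ∪ {i}, i).
  refine Finset.sum_bij' (fun s _ => ⟨insert s.2 s.1, s.2⟩) (fun s _ => ⟨s.1.erase s.2, s.2⟩)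
    ?_ ?_ ?_ ?_ ?_
  · rintro ⟨J, i⟩ h
    simp only [Finset.mem_sigma, Finset.mem_powerset, Finset.mem_sdiff] at h ⊢
    exact ⟨Finset.insert_subset h.2.1 h.1, Finset.mem_insert_self _ _⟩
  · rintro ⟨J, i⟩ h
    simp only [Finset.mem_sigma, Finset.mem_powerset, Finset.mem_sdiff] at h ⊢
    exact ⟨(Finset.erase_subset _ _).trans h.1, h.1 h.2, Finset.notMem_erase _ _⟩
  · rintro ⟨J, i⟩ h
    simp only [Finset.mem_sigma, Finset.mem_powerset, Finset.mem_sdiff] at h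
    simp [Finset.erase_insert h.2.2]
  · rintro ⟨J, i⟩ h
    simp only [Finset.mem_sigma, Finset.mem_powerset] at h
    simp [Finset.insert_erase h.2]
  · rintro ⟨J, i⟩ h
    simp only [Finset.mem_sigma, Finset.mem_powerset, Finset.mem_sdiff] at h ⊢
    obtain ⟨hJ, hiK, hiJ⟩ := h
    have hkJ : k ∉ J := fun h => hkK (hJ h)
    have hik : i < k := hlt i hiK
    have hkiJ : k ∉ insert i J := by simp [hik.ne', hkJ]
    have e1 : (insert k (insert i J)).erase i = insert k J := by
      rw [Finset.insert_comm, Finset.erase_insert (by simp [hik.ne, hiJ])]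
    -- The extra 1 comes from k > i; its sign offsets the one from |J ∪ {i}| = |J| + 1.
    have e2 : ((insert k (insert i J)).filter (i < ·)).card = (J.filter (i < ·)).card + 1 := by
      rw [Finset.filter_insert, if_pos hik, Finset.filter_insert, if_neg (lt_irrefl i),
        Finset.card_insert_of_notMem (by simp [hkJ])]
    have hmem : i ∈ M - (insert k J).val := by
      rw [Multiset.mem_sub, Multiset.count_eq_zero_of_notMem (by simp [hik.ne, hiJ])]
      exact Multiset.count_pos.2 (by simpa using Finset.mem_of_mem_erase hiK)
    have e3 : M - (insert i J).val = (M - J.val).erase i := sub_val_insert M hiJ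
    have e4 : i ::ₘ (M - (insert k (insert i J)).val) = M - (insert k J).val := by
      rw [Finset.insert_comm, sub_val_insert M (a := i) (by simp [hik.ne, hiJ]),
        Multiset.cons_erase hmem]
    rw [e1, e2, e4, e3, altSum_cons_sort hX hiJ, Finset.card_insert_of_notMem hiJ]
    simp only [pow_succ, neg_mul, mul_neg, neg_neg, mul_assoc, one_mul]

end RightQuantum

/-! ### Inversions under adding an end letter. -/

section Inversions

variable {r : ℕ}

theorem invCount_nil : invCount ([] : List (Fin r)) = 0 := by
  rw [invCount, Finset.card_eq_zero, Finset.filter_eq_empty_iff]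
  exact fun p => p.1.elim0

theorem invCount_cons (x : Fin r) (w : List (Fin r)) :
    invCount (x :: w) = w.countP (· < x) + invCount w := by
  have h : ∀ v : List (Fin r), invCount v = ∑ i : Fin v.length, ∑ j : Fin v.length,
      if i < j ∧ v.get j < v.get i then 1 else 0 := by
    intro v
    rw [invCount, Finset.card_filter, Fintype.sum_prod_type]
  have hc : w.countP (· < x) = ∑ j : Fin w.length, if w.get j < x then 1 else 0 := by
    rw [← Multiset.coe_countP, Multiset.countP_eq_card_filter, ← Finset.card_filter]
    conv_lhs => rw [← List.ofFn_get w, List.ofFn_eq_map]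
    rw [← Multiset.map_coe, Multiset.filter_map, Multiset.card_map]
    rfl
  rw [h, h, hc]
  change ∑ i : Fin (w.length + 1), ∑ j : Fin (w.length + 1), _ = _
  rw [Fin.sum_univ_succ]
  congr 1
  · rw [Fin.sum_univ_succ]
    simp
  · refine Finset.sum_congr rfl fun i _ => ?_
    rw [Fin.sum_univ_succ]
    simp

theorem invCount_concat (w : List (Fin r)) (x : Fin r) :
    invCount (w ++ [x]) = invCount w + w.countP (x < ·) := by
  induction w with
  | nil => simp [invCount_cons]
  | cons y w ih =>
    rw [List.cons_append, invCount_cons, ih, invCount_cons, List.countP_append, List.countP_cons]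
    simp only [List.countP_nil, List.countP_cons, decide_eq_true_eq]
    omega

end Inversions

/-! ### Coefficients of the symmetric and alternating sums of biletters. -/

namespace Expr

variable {K : Type} [CommRing K] {r : ℕ}

theorem sum_apply {ι : Type*} (s : Finset ι) (f : ι → Expr K r) (β : Biword r) :
    (∑ i ∈ s, f i) β = ∑ i ∈ s, f i β :=
  map_sum (⟨⟨fun E => E β, rfl⟩, fun _ _ => rfl⟩ : Expr K r →+ K) f s

theorem neg_one_pow_mul_apply (n : ℕ) (E : Expr K r) (β : Biword r) :
    ((-1) ^ n * E) β = (-1) ^ n * E β := by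
  induction n with
  | zero => simp
  | succ n ih => rw [pow_succ', pow_succ', mul_assoc, neg_one_mul, neg_apply, ih]; ring

theorem mul_nil (E F : Expr K r) : (E * F) [] = E [] * F [] := by
  simp [mul_apply]

theorem single_cons_mul (c d : Fin r × Fin r) (E : Expr K r) (γ : Biword r) :
    (single [c] * E : Expr K r) (d :: γ) = if d = c then E γ else 0 := by
  rw [mul_apply, Finset.sum_eq_single 1]
  · simp [single]
  · intro i hi h1
    rw [Finset.mem_range, List.length_cons] at hi
    rw [single, if_neg, zero_mul]
    intro h
    have := congrArg List.length h
    rw [List.length_take, List.length_cons, List.length_singleton] at this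
    omega
  · simp

theorem mul_single_concat (c d : Fin r × Fin r) (E : Expr K r) (γ : Biword r) :
    (E * single [c] : Expr K r) (γ ++ [d]) = if d = c then E γ else 0 := by
  rw [mul_apply, Finset.sum_eq_single γ.length]
  · simp [single]
  · intro i hi h1
    rw [Finset.mem_range, List.length_append, List.length_singleton] at hi
    rw [single, if_neg, mul_zero]
    intro h
    have := congrArg List.length h
    rw [List.length_drop, List.length_append, List.length_singleton, List.length_singleton] at this
    omega
  · simp

theorem single_cons (c : Fin r × Fin r) (α : Biword r) :
    (single (c :: α) : Expr K r) = single [c] * single α := by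
  ext β
  cases β with
  | nil => rw [mul_nil]; simp [single]
  | cons d γ => rw [single_cons_mul]; simp only [single, List.cons.injEq, ite_and]

/-- The matrix of biletters. -/
def letter (K : Type) [CommRing K] (r : ℕ) (x a : Fin r) : Expr K r := single [(x, a)]

theorem letter_mul_nil (x a : Fin r) (E : Expr K r) : (letter K r x a * E) [] = 0 := by
  rw [mul_nil, letter, single, if_neg (by simp), zero_mul]

theorem mul_letter_nil (x a : Fin r) (E : Expr K r) : (E * letter K r x a) [] = 0 := by
  rw [mul_nil, letter, single, if_neg (by simp), mul_zero]

theorem letter_mul_cons (x a y b : Fin r) (E : Expr K r) (γ : Biword r) :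
    (letter K r x a * E) ((y, b) :: γ) = if y = x ∧ b = a then E γ else 0 := by
  rw [letter, single_cons_mul]
  exact if_congr Prod.mk_inj rfl rfl

theorem mul_letter_concat (x a y b : Fin r) (E : Expr K r) (γ : Biword r) :
    (E * letter K r x a) (γ ++ [(y, b)]) = if y = x ∧ b = a then E γ else 0 := by
  rw [letter, mul_single_concat]
  exact if_congr Prod.mk_inj rfl rfl

theorem symSum_letter_apply (u : List (Fin r)) (p : Multiset (Fin r)) (β : Biword r) :
    symSum (letter K r) u p β =
      if β.map Prod.fst = u ∧ (β.map Prod.snd : Multiset (Fin r)) = p then 1 else 0 := by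
  induction u generalizing p β with
  | nil =>
    rw [symSum]
    cases β with
    | nil => by_cases h : p = 0 <;> simp [h, one_apply, zero_apply, eq_comm]
    | cons d γ => by_cases h : p = 0 <;> simp [h, one_apply, zero_apply]
  | cons x u ih =>
    rw [symSum, sum_apply]
    cases β with
    | nil => simp [letter_mul_nil]
    | cons d γ =>
      obtain ⟨y, a⟩ := d
      simp only [letter_mul_cons, ih]
      by_cases hy : y = x
      · subst hy
        simp only [true_and, Finset.sum_ite_eq, Multiset.mem_toFinset, List.map_cons,
          List.cons.injEq]
        simp only [← ite_and]
        refine if_congr ?_ rfl rfl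
        rw [← Multiset.cons_coe]
        constructor
        · rintro ⟨h1, h2, h3⟩
          exact ⟨h2, by rw [h3, Multiset.cons_erase h1]⟩
        · rintro ⟨h1, h2⟩
          subst h2
          simp [h1]
      · simp [hy]

/-- The expansion removes the last biletter, hence the induction from the right and the reversal of
b. The sign of each step counts the larger top letters standing before the removed one. -/
theorem altSum_letter_apply (J : Finset (Fin r)) (b : List (Fin r)) (β : Biword r) :
    altSum (letter K r) J b β =
      if β.map Prod.snd = b.reverse ∧ (β.map Prod.fst : Multiset (Fin r)) = J.val then
        (-1) ^ invCount (β.map Prod.fst) else 0 := by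
  induction b generalizing J β with
  | nil =>
    rw [altSum]
    cases β with
    | nil =>
      by_cases h : J = ∅
      · simp [h, one_apply, invCount_nil]
      · have : ¬ (0 = J.val) := fun h' => h (Finset.val_eq_zero.1 h'.symm)
        simp [h, this, zero_apply]
    | cons d γ => by_cases h : J = ∅ <;> simp [h, one_apply, zero_apply]
  | cons i b ih =>
    rw [altSum, sum_apply]
    induction β using List.reverseRecOn with
    | nil => simp [mul_letter_nil]
    | append_singleton γ d _ =>
      obtain ⟨y, a⟩ := d
      have hm : ((γ ++ [(y, a)]).map Prod.fst : Multiset (Fin r)) = J.val ↔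
          y ∈ J ∧ (γ.map Prod.fst : Multiset (Fin r)) = (J.erase y).val := by
        rw [List.map_append, List.map_singleton, ← Multiset.coe_add, Multiset.coe_singleton,
          add_comm, Multiset.singleton_add, Finset.erase_val]
        constructor
        · intro h
          exact ⟨by rw [← Finset.mem_val, ← h]; simp, by simp [← h]⟩
        · rintro ⟨h1, h2⟩
          rw [h2, Multiset.cons_erase h1]
      have hs : (γ ++ [(y, a)]).map Prod.snd = (i :: b).reverse ↔
          a = i ∧ γ.map Prod.snd = b.reverse := by
        rw [List.map_append, List.reverse_cons, List.map_singleton, ← List.concat_eq_append,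
          ← List.concat_eq_append, List.concat_inj, and_comm]
      have hsum : ∀ f : Fin r → K,
          (∑ j ∈ J, if y = j ∧ a = i then f j else 0) = if y ∈ J ∧ a = i then f y else 0 := by
        intro f
        by_cases ha : a = i <;> simp [ha]
      simp only [mul_letter_concat, neg_one_pow_mul_apply, ih, hm, hs, hsum]
      by_cases h : (a = i ∧ γ.map Prod.snd = b.reverse) ∧
          y ∈ J ∧ (γ.map Prod.fst : Multiset (Fin r)) = (J.erase y).val
      · obtain ⟨⟨ha, h1⟩, hy, h2⟩ := h
        have hc : (J.filter (y < ·)).card = (γ.map Prod.fst).countP (y < ·) := by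
          rw [← Multiset.coe_countP, h2, Multiset.countP_eq_card_filter,
            ← Finset.filter_val, Finset.card_val, Finset.filter_erase,
            Finset.erase_eq_of_notMem (by simp)]
        rw [if_pos ⟨hy, ha⟩, if_pos ⟨h1, h2⟩, if_pos ⟨⟨ha, h1⟩, hy, h2⟩, List.map_append,
          List.map_singleton, invCount_concat, hc, pow_add, mul_comm]
      · rw [if_neg h]
        split_ifs with h1 h2
        · exact absurd ⟨⟨h1.2, h2.1⟩, h1.1, h2.2⟩ h
        · exact mul_zero _
        · rfl

end Expr

/-! ### The Fermion and the Boson as diagonal entries. -/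

section Fermion

variable {r : ℕ}

theorem map_snd_permBiword (J : Finset (Fin r)) (σ : Equiv.Perm J) :
    (permBiword J σ).map Prod.snd = J.sort (· ≤ ·) := by
  have h : (J.attach.map (Function.Embedding.subtype _)) = J := Finset.attach_map_val
  conv_rhs => rw [← h]
  rw [← Finset.map_sort (r := (· ≤ ·)) (hs := fun _ _ _ _ => Iff.rfl), permBiword, List.map_map]
  rfl

theorem coe_map_fst_permBiword (J : Finset (Fin r)) (σ : Equiv.Perm J) :
    ((permBiword J σ).map Prod.fst : Multiset (Fin r)) = J.val := by
  have h1 : (permBiword J σ).map Prod.fst =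
      ((J.attach.sort (· ≤ ·)).map σ).map Subtype.val := by
    rw [permBiword, List.map_map, List.map_map]; rfl
  have h2 : J.attach.val.map σ = J.attach.val := by
    have := congrArg Finset.val (Finset.map_univ_equiv σ)
    rwa [Finset.map_val] at this
  rw [h1, ← Multiset.map_coe, ← Multiset.map_coe, Finset.sort_eq, h2]
  exact Multiset.attach_map_val J.val

theorem permBiword_injective (J : Finset (Fin r)) : Function.Injective (permBiword J) := by
  intro σ τ h
  ext i
  have := List.map_inj_left.1 h i (by simp)
  exact congrArg Fin.val (Prod.mk.inj this).1

theorem exists_perm_map_eq {α : Type*} [DecidableEq α] {L u : List α} (hL : L.Nodup)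
    (hmem : ∀ x, x ∈ L) (h : u.Perm L) : ∃ σ : Equiv.Perm α, L.map σ = u := by
  let e := hL.getEquivOfForallMemList L hmem
  let e' := (h.nodup_iff.2 hL).getEquivOfForallMemList u fun x => h.mem_iff.2 (hmem x)
  refine ⟨e.symm.trans ((finCongr h.length_eq.symm).trans e'), ?_⟩
  refine List.ext_getElem (by simp [h.length_eq]) fun i h1 h2 => ?_
  rw [List.length_map] at h1
  have : e.symm L[i] = ⟨i, h1⟩ := by rw [Equiv.symm_apply_eq]; rfl
  rw [List.getElem_map, Equiv.trans_apply, this]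
  rfl

/-- Lets the sum over permutations in the Fermion be read as a sum over biwords. -/
theorem exists_permBiword_eq {J : Finset (Fin r)} {β : Biword r}
    (h1 : β.map Prod.snd = J.sort (· ≤ ·))
    (h2 : (β.map Prod.fst : Multiset (Fin r)) = J.val) : ∃ σ, permBiword J σ = β := by
  have hm : ∀ x ∈ β.map Prod.fst, x ∈ J := fun x hx => by
    rw [← Finset.mem_val, ← h2]; exact hx
  obtain ⟨u, hu⟩ : ∃ u : List J, u.map Subtype.val = β.map Prod.fst :=
    ⟨(β.map Prod.fst).attachWith _ hm, List.attachWith_map_subtype_val _⟩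
  have hp : u.Perm (J.attach.sort (· ≤ ·)) := by
    rw [← Multiset.coe_eq_coe, Finset.sort_eq]
    apply Multiset.map_injective Subtype.val_injective
    rw [Multiset.map_coe, hu, h2]
    exact (Multiset.attach_map_val J.val).symm
  obtain ⟨σ, hσ⟩ := exists_perm_map_eq (Finset.sort_nodup _ _) (fun x => by simp) hp
  refine ⟨σ, ?_⟩
  have h3 : (permBiword J σ).map Prod.fst = β.map Prod.fst := by
    rw [← hu, ← hσ, permBiword, List.map_map, List.map_map]; rfl
  rw [List.zip_of_prod h3 ((map_snd_permBiword J σ).trans h1.symm)]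
  exact (List.zip_of_prod rfl rfl).symm

theorem reverse_sort_ge (J : Finset (Fin r)) :
    (J.sort (· ≥ ·)).reverse = J.sort (· ≤ ·) := by
  refine List.Perm.eq_of_pairwise (le := (· ≤ ·)) (fun a b _ _ h h' => le_antisymm h h')
    (List.pairwise_reverse.2 (Finset.pairwise_sort J (· ≥ ·))) (Finset.pairwise_sort _ _) ?_
  rw [← Multiset.coe_eq_coe, Finset.sort_eq, Multiset.coe_reverse, Finset.sort_eq]

variable {K : Type} [CommRing K]

theorem fermOne_eq : fermOne K r = ∑ J : Finset (Fin r),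
    (-1) ^ J.card * altSum (Expr.letter K r) J (J.sort (· ≥ ·)) := by
  refine Finset.sum_congr rfl fun J _ => ?_
  ext β
  rw [Expr.sum_apply, Expr.neg_one_pow_mul_apply, Expr.altSum_letter_apply, reverse_sort_ge]
  simp only [Expr.smul_apply, Expr.single]
  split_ifs with h
  · obtain ⟨σ, rfl⟩ := exists_permBiword_eq h.1 h.2
    rw [Finset.sum_eq_single σ]
    · simp
    · intro τ _ hτ
      rw [if_neg fun e => hτ (permBiword_injective J e).symm, mul_zero]
    · simp
  · rw [mul_zero]
    refine Finset.sum_eq_zero fun σ _ => ?_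
    rw [if_neg, mul_zero]
    rintro rfl
    exact h ⟨map_snd_permBiword J σ, coe_map_fst_permBiword J σ⟩

/-- The Boson collects the diagonal entries on S: each biword is tested against the entry of its own
bottom content. -/
theorem bos_one_apply (β : Biword r) :
    bos r (1 : K) β = symSum (Expr.letter K r)
      ((β.map Prod.snd : Multiset (Fin r)).sort (· ≤ ·)) (β.map Prod.snd) β := by
  rw [Expr.symSum_letter_apply, bos, Multiset.coe_sort, one_pow]
  refine if_congr ?_ rfl rfl
  rw [and_iff_left rfl, ← List.mergeSort_eq_insertionSort]

/-- The coefficient of `β` in the part of content `M` of the product. -/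
theorem koszulTrace_letter_apply (M : Multiset (Fin r)) (β : Biword r) :
    koszulTrace (Expr.letter K r) M β =
      if (β.map Prod.snd : Multiset (Fin r)) = M then (fermOne K r * bos r 1 : Expr K r) β else 0 := by
  -- The Fermion factor has bottom content J, which forces content M - J on the Boson factor.
  have hD : ∀ (J : Finset (Fin r)) (γ : Biword r),
      altSum (Expr.letter K r) J (J.sort (· ≥ ·)) γ ≠ 0 →
        (γ.map Prod.snd : Multiset (Fin r)) = J.val := by
    intro J γ h
    rw [Expr.altSum_letter_apply] at h
    rw [(ite_ne_right_iff.1 h).1.1, reverse_sort_ge, Finset.sort_eq]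
  have hsplit : ∀ i : ℕ, (β.map Prod.snd : Multiset (Fin r)) =
      ((β.take i).map Prod.snd : Multiset (Fin r)) + ((β.drop i).map Prod.snd : Multiset _) := by
    intro i
    rw [Multiset.coe_add, ← List.map_append, List.take_append_drop]
  rw [koszulTrace, Expr.sum_apply]
  simp only [Expr.neg_one_pow_mul_apply]
  split_ifs with h
  · rw [fermOne_eq, Finset.sum_mul, Expr.sum_apply]
    symm
    refine Finset.sum_subset_zero_on_sdiff (Finset.subset_univ _) ?_ ?_ |>.symm
    -- A set J not contained in M cannot be the content of a prefix of β.
    · intro J hJ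
      rw [mul_assoc, Expr.neg_one_pow_mul_apply, Expr.mul_apply, Finset.sum_eq_zero, mul_zero]
      intro i _
      by_contra hne
      have := hD J _ (left_ne_zero_of_mul hne)
      rw [Finset.mem_sdiff, Finset.mem_powerset] at hJ
      refine hJ.2 fun x hx => ?_
      rw [Multiset.mem_toFinset, ← h, hsplit i, this]
      exact Multiset.mem_add.2 (Or.inl hx)
    · intro J _
      rw [mul_assoc, Expr.neg_one_pow_mul_apply, Expr.mul_apply, Expr.mul_apply]
      congr 1
      refine Finset.sum_congr rfl fun i _ => ?_
      by_cases h0 : altSum (Expr.letter K r) J (J.sort (· ≥ ·)) (β.take i) = 0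
      · rw [h0, zero_mul, zero_mul]
      · rw [bos_one_apply, ← h, hsplit i, hD J _ h0, add_tsub_cancel_left]
  · refine Finset.sum_eq_zero fun J hJ => ?_
    rw [Expr.mul_apply, Finset.sum_eq_zero, mul_zero]
    intro i _
    by_contra hne
    have h1 := hD J _ (left_ne_zero_of_mul hne)
    have h2 := right_ne_zero_of_mul hne
    rw [Expr.symSum_letter_apply] at h2
    have h3 := (ite_ne_right_iff.1 h2).1.2
    apply h
    rw [hsplit i, h1, h3]
    exact add_tsub_cancel_of_le
      ((Multiset.le_iff_subset J.nodup).2 fun x hx => by simpa using Finset.mem_powerset.1 hJ hx)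

end Fermion

/-! ### The right-quantum relations from (SH). -/

section Contextual

variable {K : Type} [CommRing K] {r : ℕ}

/-- No factor vanishes, being an integer minus 1/2; so for x > y exactly one of the two relations
applies. -/
theorem contextV_ne_zero (x y a b : Fin r) : contextV x y a b ≠ 0 := by
  have h : ∀ m n : ℕ, ((m : ℚ) - n - 1 / 2) ≠ 0 := by
    intro m n h
    have h' : ((2 * m : ℕ) : ℚ) = ((2 * n + 1 : ℕ) : ℚ) := by push_cast; linarith
    have := Nat.cast_injective h'
    omega
  exact mul_ne_zero (mul_ne_zero (mul_ne_zero (h _ _) (h _ _)) (h _ _)) (h _ _)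

theorem contextV_swap (x y a b : Fin r) : contextV x y b a = contextV x y a b := by
  unfold contextV; ring

theorem contextV_self_pos (x y a : Fin r) : 0 < contextV x y a a := by
  refine lt_of_le_of_ne ?_ (contextV_ne_zero x y a a).symm
  unfold contextV
  rw [mul_assoc]
  exact mul_self_nonneg _

/-- The matrix of biletters satisfies the right-quantum relations in the quotient by `(SH)`. -/
theorem isRightQuantum_letter : IsRightQuantum fun x a =>
    (algebraicIdeal (systemSH K r)).ringCon.mk' (Expr.letter K r x a) := by
  set f := (algebraicIdeal (systemSH K r)).ringCon.mk' with hf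
  have hrel : ∀ p ∈ systemSH K r, f (Expr.single p.1) = f p.2 := by
    intro p hp
    have h : Expr.single p.1 - p.2 ∈ algebraicIdeal (systemSH K r) :=
      TwoSidedIdeal.subset_span ⟨p, hp, rfl⟩
    exact (RingCon.eq _).2 ((TwoSidedIdeal.rel_iff _ _ _).2 h)
  have hpos : ∀ x y a b, y < x → 0 < contextV x y a b →
      f (Expr.letter K r x a) * f (Expr.letter K r y b) =
        f (Expr.letter K r y a) * f (Expr.letter K r x b) := by
    intro x y a b hxy hV
    have : f (Expr.single [(x, a), (y, b)]) = f (Expr.single [(y, a), (x, b)]) :=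
      hrel _ (Or.inl ⟨x, y, a, b, hxy, hV, rfl⟩)
    rwa [Expr.single_cons (x, a) [(y, b)], Expr.single_cons (y, a) [(x, b)], map_mul, map_mul] at this
  have hneg : ∀ x y a b, y < x → contextV x y a b < 0 →
      f (Expr.letter K r x a) * f (Expr.letter K r y b) =
        f (Expr.letter K r y b) * f (Expr.letter K r x a) := by
    intro x y a b hxy hV
    have : f (Expr.single [(x, a), (y, b)]) = f (Expr.single [(y, b), (x, a)]) :=
      hrel _ (Or.inr ⟨x, y, a, b, hxy, hV, rfl⟩)
    rwa [Expr.single_cons (x, a) [(y, b)], Expr.single_cons (y, b) [(x, a)], map_mul, map_mul] at this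
  -- V is unchanged by exchanging a and b, so the same relation rewrites both products, and either
  -- relation gives the same sum.
  have hcross : ∀ x y a b, y < x →
      f (Expr.letter K r x a) * f (Expr.letter K r y b) +
        f (Expr.letter K r x b) * f (Expr.letter K r y a) =
      f (Expr.letter K r y a) * f (Expr.letter K r x b) +
        f (Expr.letter K r y b) * f (Expr.letter K r x a) := by
    intro x y a b hxy
    rcases (contextV_ne_zero x y a b).lt_or_gt with h | h
    · rw [hneg x y a b hxy h, hneg x y b a hxy (by rwa [contextV_swap]), add_comm]
    · rw [hpos x y a b hxy h, hpos x y b a hxy (by rwa [contextV_swap])]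
  constructor
  · intro x y a
    rcases lt_trichotomy x y with h | rfl | h
    · exact (hpos y x a a h (contextV_self_pos _ _ _)).symm
    · rfl
    · exact hpos x y a a h (contextV_self_pos _ _ _)
  · intro x y a b
    rcases lt_trichotomy x y with h | rfl | h
    · exact (hcross y x a b h).symm
    · rfl
    · exact hcross x y a b h

theorem koszulTrace_letter_mem {M : Multiset (Fin r)} (hM : M ≠ 0) :
    koszulTrace (Expr.letter K r) M ∈ algebraicIdeal (systemSH K r) := by
  have h := koszulTrace_eq_zero (isRightQuantum_letter (K := K) (r := r)) hM
  have h' : (algebraicIdeal (systemSH K r)).ringCon.mk' (koszulTrace (Expr.letter K r) M) = 0 := by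
    rw [← h]
    simp only [koszulTrace, map_sum, map_mul, map_pow, map_neg, map_one, map_altSum, map_symSum]
  rw [TwoSidedIdeal.mem_iff]
  exact (RingCon.eq _).1 h'

theorem fermOne_mul_bos_nil : (fermOne K r * bos r 1 : Expr K r) [] = 1 := by
  have h := koszulTrace_letter_apply (K := K) (r := r) 0 []
  rw [List.map_nil, if_pos Multiset.coe_nil] at h
  rw [← h]
  simp [koszulTrace, altSum, symSum, Expr.one_apply]

end Contextual

/-! ### Passage to the closed ideal. -/

theorem mainTheorem5 (r : ℕ) :
    (toQuotient (systemSH (LaurentPolynomial ℤ) r)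
      (fermOne (LaurentPolynomial ℤ) r * bos r 1) : ContextualAlgebra r) = 1 := by
  rw [← map_one (toQuotient (systemSH (LaurentPolynomial ℤ) r))]
  refine (RingCon.eq _).2 ((TwoSidedIdeal.rel_iff _ _ _).2 ?_)
  rw [reductionIdeal, TwoSidedIdeal.mem_mk']
  intro N
  -- A biword of length below N uses each letter fewer than N times, so its content lies under N
  -- copies of the alphabet. The content 0 is left out: it accounts for the constant term 1.
  let s : Finset (Multiset (Fin r)) := (Finset.Icc 0 (N • Finset.univ.val)).erase 0
  refine ⟨∑ M ∈ s, koszulTrace (Expr.letter (LaurentPolynomial ℤ) r) M, ?_, fun β hβ => ?_⟩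
  · exact sum_mem fun M hM => koszulTrace_letter_mem (Finset.ne_of_mem_erase hM)
  · rw [Expr.sum_apply]
    simp only [koszulTrace_letter_apply, Finset.sum_ite_eq]
    rw [Expr.sub_apply, Expr.one_apply]
    cases β with
    | nil => simp [s, fermOne_mul_bos_nil]
    | cons c γ =>
      rw [if_neg (by simp), sub_zero, if_pos]
      refine Finset.mem_erase.2 ⟨by simp, Finset.mem_Icc.2 ⟨Multiset.zero_le _, ?_⟩⟩
      rw [Multiset.le_iff_count]
      intro a
      rw [Multiset.count_nsmul, Multiset.count_eq_one_of_mem Finset.univ.nodup (Finset.mem_univ a),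
        mul_one]
      refine (Multiset.count_le_card _ _).trans ?_
      rw [Multiset.coe_card, List.length_map]
      exact hβ.le
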